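/- Let $Q_1,Q_2,Q_3\in\mathbb R[u,v,w]$ be quadratic forms such that the plane quartic curve $$\Delta=(Q_1Q_3-Q_2^2=0)\subset\mathbb P^2_{\mathbb R}$$ is smooth. Let $Y$ and $Y^-$ be the double covers of $\mathbb P^1_{[t_0:t_1]}\times\mathbb P^2_{[u:v:w]}$ over $\mathbb R$ given by $$Y:\ z^2=t_0^2Q_1+2t_0t_1Q_2+t_1^2Q_3,\qquad Y^-:\ z^2=-t_0^2Q_1+2t_0t_1Q_2-t_1^2Q_3,$$ where $z$ has bidegree $(1,1)$. (These are the threefolds $Y_{\tilde\Delta/\Delta}$ and $Y_{\tilde\Delta^- /\Delta}$ associated to the étale double cover $\tilde\Delta=(Q_1-r^2=Q_2-rs=Q_3-s^2=0)\to\Delta$ and to its quadratic twist $\tilde\Delta^-=(Q_1+r^2=Q_2-rs=Q_3+s^2=0)\to\Delta$.) If $\Delta(\mathbb R)\neq\emptyset$, then at least one of $Y$ and $Y^-$ is rational over $\mathbb R$, that is, birational over $\mathbb R$ to $\mathbb P^3_{\mathbb R}$. -/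

import Mathlib

open MvPolynomial AlgebraicGeometry CategoryTheory

noncomputable section

namespace DoubleCover

/-! ### Two operations on graded algebras -/

section Graded

variable {R A : Type*} [CommRing R] [CommRing A] [Algebra R A]

/-- A spanning family of submodules is an internal direct sum as soon as it is separated by a
family of additive maps. -/
theorem isInternal_of_separated {ι M P : Type*} [DecidableEq ι] [AddCommGroup M] [Module R M]
    [AddCommGroup P] (N : ι → Submodule R M) (p : ι → M →+ P)
    (h_same : ∀ i, ∀ x ∈ N i, p i x = 0 → x = 0)
    (h_ne : ∀ i j, j ≠ i → ∀ x ∈ N j, p i x = 0)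
    (h_span : ⨆ i, N i = ⊤) : DirectSum.IsInternal N := by
  classical
  refine DirectSum.isInternal_submodule_of_iSupIndep_of_iSup_eq_top ?_ h_span
  intro i
  rw [disjoint_iff, eq_bot_iff]
  rintro x ⟨hx, hx'⟩
  refine h_same i x hx ?_
  refine Submodule.iSup_induction (motive := fun y => p i y = 0) _ hx' ?_ (map_zero _) ?_
  · intro j y hy
    by_cases hj : j = i
    · subst hj
      have : y = 0 := by simpa using hy
      simp [this]
    · exact h_ne i j hj y (by simpa [hj] using hy)
  · intro y z hy hz
    rw [map_add, hy, hz, add_zero]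

/-- The graded pieces of the quotient `A ⧸ I` of a graded algebra: the images of those of `A`. -/
def quotientGrading {ι : Type*} (𝒜 : ι → Submodule R A) (I : Ideal A) (i : ι) :
    Submodule R (A ⧸ I) :=
  (𝒜 i).map (Ideal.Quotient.mkₐ R I).toLinearMap

instance quotientGrading_gradedMonoid {ι : Type*} [AddMonoid ι] (𝒜 : ι → Submodule R A)
    [SetLike.GradedMonoid 𝒜] (I : Ideal A) :
    SetLike.GradedMonoid (quotientGrading 𝒜 I) where
  one_mem := ⟨1, SetLike.GradedOne.one_mem, map_one (Ideal.Quotient.mkₐ R I)⟩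
  mul_mem := by
    rintro i j _ _ ⟨a, ha, rfl⟩ ⟨b, hb, rfl⟩
    exact ⟨a * b, SetLike.GradedMul.mul_mem ha hb, map_mul (Ideal.Quotient.mkₐ R I) a b⟩

theorem quotientGrading_isInternal {ι : Type*} [DecidableEq ι] [AddMonoid ι]
    (𝒜 : ι → Submodule R A) [GradedAlgebra 𝒜] (I : Ideal A) (hI : I.IsHomogeneous 𝒜) :
    DirectSum.IsInternal (quotientGrading 𝒜 I) := by
  let p : ι → (A ⧸ I) →+ (A ⧸ I) := fun i =>
    QuotientAddGroup.map I.toAddSubgroup I.toAddSubgroup (GradedRing.proj 𝒜 i)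
      (fun a ha => hI i ha)
  have hp : ∀ i (a : A), p i (Ideal.Quotient.mk I a) =
      Ideal.Quotient.mk I (GradedRing.proj 𝒜 i a) := fun i a => rfl
  refine isInternal_of_separated _ p ?_ ?_ ?_
  · rintro i _ ⟨a, ha, rfl⟩ h
    have h' : p i (Ideal.Quotient.mk I a) = 0 := h
    rw [hp, GradedRing.proj_apply, DirectSum.decompose_of_mem_same 𝒜 ha] at h'
    exact h'
  · rintro i j hij _ ⟨a, ha, rfl⟩
    change p i (Ideal.Quotient.mk I a) = 0
    rw [hp, GradedRing.proj_apply, DirectSum.decompose_of_mem_ne 𝒜 ha hij, map_zero]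
  · have h := (DirectSum.Decomposition.isInternal 𝒜).submodule_iSup_eq_top
    unfold quotientGrading
    rw [← Submodule.map_iSup, h, Submodule.map_top, LinearMap.range_eq_top]
    exact Ideal.Quotient.mkₐ_surjective R I

/-- The quotient of a graded algebra by a homogeneous ideal is a graded algebra. -/
@[reducible]
def quotientGradedAlgebra {ι : Type*} [DecidableEq ι] [AddMonoid ι]
    (𝒜 : ι → Submodule R A) [GradedAlgebra 𝒜] (I : Ideal A) (hI : I.IsHomogeneous 𝒜) :
    GradedAlgebra (quotientGrading 𝒜 I) :=
  (quotientGrading_isInternal 𝒜 I hI).gradedAlgebra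

/-- The diagonal subalgebra `⨁ₙ 𝒜 (n, n)` of a bigraded algebra. -/
def diagonal (𝒜 : ℕ × ℕ → Submodule R A) [SetLike.GradedMonoid 𝒜] : Subalgebra R A :=
  (⨆ n : ℕ, 𝒜 (n, n)).toSubalgebra
    (Submodule.mem_iSup_of_mem 0 (SetLike.GradedOne.one_mem (A := 𝒜)))
    (fun x y hx hy => by
      refine Submodule.iSup_induction _ (motive := fun x => x * y ∈ _) hx (fun n a ha => ?_)
        (by simp) (fun a b ha hb => by rw [add_mul]; exact add_mem ha hb)
      refine Submodule.iSup_induction _ (motive := fun y => a * y ∈ _) hy (fun m b hb => ?_)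
        (by simp) (fun b c hb hc => by rw [mul_add]; exact add_mem hb hc)
      exact Submodule.mem_iSup_of_mem (n + m) (SetLike.GradedMul.mul_mem ha hb))

/-- The piece of degree `n` of the diagonal subalgebra is `𝒜 (n, n)`. -/
def diagonalGrading (𝒜 : ℕ × ℕ → Submodule R A) [SetLike.GradedMonoid 𝒜] (n : ℕ) :
    Submodule R (diagonal 𝒜) :=
  (𝒜 (n, n)).comap (diagonal 𝒜).val.toLinearMap

instance diagonalGrading_gradedMonoid (𝒜 : ℕ × ℕ → Submodule R A) [SetLike.GradedMonoid 𝒜] :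
    SetLike.GradedMonoid (diagonalGrading 𝒜) where
  one_mem := SetLike.GradedOne.one_mem (A := 𝒜)
  mul_mem := fun _ _ _ _ ha hb => SetLike.GradedMul.mul_mem (A := 𝒜) ha hb

theorem diagonalGrading_isInternal (𝒜 : ℕ × ℕ → Submodule R A) [GradedAlgebra 𝒜] :
    DirectSum.IsInternal (diagonalGrading 𝒜) := by
  refine isInternal_of_separated _
    (fun n => (GradedRing.proj 𝒜 (n, n)).comp (diagonal 𝒜).val.toRingHom.toAddMonoidHom) ?_ ?_ ?_
  · intro n x hx h
    have h' : GradedRing.proj 𝒜 (n, n) (x : A) = 0 := h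
    have hx' : (x : A) ∈ 𝒜 (n, n) := hx
    rw [GradedRing.proj_apply, DirectSum.decompose_of_mem_same 𝒜 hx'] at h'
    exact Subtype.ext h'
  · intro n m hmn x hx
    change GradedRing.proj 𝒜 (n, n) (x : A) = 0
    have hx' : (x : A) ∈ 𝒜 (m, m) := hx
    rw [GradedRing.proj_apply, DirectSum.decompose_of_mem_ne 𝒜 hx' (by simpa using hmn)]
  · rw [eq_top_iff]
    rintro ⟨x, hx⟩ -
    have key : ∀ n, ∀ a ∈ 𝒜 (n, n), a ∈ (⨆ i, diagonalGrading 𝒜 i).map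
        (diagonal 𝒜).val.toLinearMap := fun n a ha =>
      ⟨⟨a, Submodule.mem_iSup_of_mem n ha⟩,
        Submodule.mem_iSup_of_mem (p := diagonalGrading 𝒜) n ha, rfl⟩
    obtain ⟨y, hy, hyx⟩ := (iSup_le key : (⨆ n : ℕ, 𝒜 (n, n)) ≤ _) hx
    have : y = ⟨x, hx⟩ := Subtype.ext hyx
    exact this ▸ hy

/-- The diagonal subalgebra of a bigraded algebra is a graded algebra. -/
@[reducible]
def diagonalGradedAlgebra (𝒜 : ℕ × ℕ → Submodule R A) [GradedAlgebra 𝒜] :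
    GradedAlgebra (diagonalGrading 𝒜) :=
  (diagonalGrading_isInternal 𝒜).gradedAlgebra

end Graded

/-! ### Double covers of `ℙ¹ × ℙ²` -/

/-- Quadratic forms in `ℝ[u, v, w]`, i.e. homogeneous polynomials of degree two. -/
abbrev TernaryQuadraticForm : Type := homogeneousSubmodule (Fin 3) ℝ 2

/-- The variables `t₀, t₁` (`Sum.inl`) and `u, v, w` (`Sum.inr`) on `ℙ¹ × ℙ²`. -/
abbrev BaseVar : Type := Fin 2 ⊕ Fin 3

/-- The variables of the double cover: those of `ℙ¹ × ℙ²` (`some`) and `z` (`none`). -/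
abbrev Var : Type := Option BaseVar

/-- The bidegrees of the variables: `t₀, t₁` have bidegree `(1, 0)`, while `u, v, w` have
bidegree `(0, 1)`. -/
def baseBidegree : BaseVar → ℕ × ℕ :=
  Sum.elim (fun _ => (1, 0)) (fun _ => (0, 1))

/-- The bidegrees of all the variables: `z` is a section of `𝒪(1, 1)`. -/
def bidegree : Var → ℕ × ℕ
  | none => (1, 1)
  | some i => baseBidegree i

/-- Bihomogeneous polynomials of bidegree `(2, 2)` in `ℝ[t₀, t₁; u, v, w]`. -/
abbrev BranchForm : Type := weightedHomogeneousSubmodule ℝ baseBidegree (2, 2)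

instance bigradedAlgebra : GradedAlgebra (weightedHomogeneousSubmodule ℝ bidegree) :=
  weightedGradedAlgebra ℝ bidegree

/-- The ideal `(z² - F)` of `ℝ[t₀, t₁, u, v, w, z]`. -/
def coverIdeal (F : BranchForm) : Ideal (MvPolynomial Var ℝ) :=
  Ideal.span {X none ^ 2 - rename some (F : MvPolynomial BaseVar ℝ)}

/-- Renaming variables compatibly with their weights preserves weighted homogeneity. -/
theorem isWeightedHomogeneous_rename {σ τ M : Type*} [AddCommMonoid M] {w : τ → M} {f : σ → τ}
    {p : MvPolynomial σ ℝ} {m : M} (hp : IsWeightedHomogeneous (w ∘ f) p m) :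
    IsWeightedHomogeneous w (rename f p) m := by
  intro d hd
  obtain ⟨e, rfl, he⟩ := coeff_rename_ne_zero f p d hd
  rw [← hp he, Finsupp.weight_apply, Finsupp.weight_apply,
    Finsupp.sum_mapDomain_index (by simp) (by simp [add_smul])]
  rfl

theorem coverIdeal_isHomogeneous (F : BranchForm) :
    (coverIdeal F).IsHomogeneous (weightedHomogeneousSubmodule ℝ bidegree) := by
  refine Ideal.homogeneous_span _ _ ?_
  rintro _ rfl
  refine ⟨(2, 2), ?_⟩
  have h1 : IsWeightedHomogeneous bidegree (X none ^ 2 : MvPolynomial Var ℝ) (2, 2) :=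
    (isWeightedHomogeneous_X ℝ bidegree none).pow 2
  exact h1.sub (isWeightedHomogeneous_rename (w := bidegree) (f := some) F.2)

/-- The bigraded pieces of `ℝ[t₀, t₁, u, v, w, z] / (z² - F)`. -/
abbrev coverBigrading (F : BranchForm) :
    ℕ × ℕ → Submodule ℝ (MvPolynomial Var ℝ ⧸ coverIdeal F) :=
  quotientGrading (weightedHomogeneousSubmodule ℝ bidegree) (coverIdeal F)

instance coverBigradedAlgebra (F : BranchForm) : GradedAlgebra (coverBigrading F) :=
  quotientGradedAlgebra _ _ (coverIdeal_isHomogeneous F)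

/-- The graded pieces of the homogeneous coordinate ring
`⨁ₙ (ℝ[t₀, t₁, u, v, w, z] / (z² - F))₍ₙ,ₙ₎` of the double cover. -/
abbrev coverGrading (F : BranchForm) : ℕ → Submodule ℝ (diagonal (coverBigrading F)) :=
  diagonalGrading (coverBigrading F)

instance coverGradedAlgebra (F : BranchForm) : GradedAlgebra (coverGrading F) :=
  diagonalGradedAlgebra _

/-- The double cover `z² = F` of `ℙ¹ × ℙ²`, for `F` of bidegree `(2, 2)` and `z` a coordinate of
bidegree `(1, 1)`. It is the (multigraded) `Proj` of `ℝ[t₀, t₁, u, v, w, z] / (z² - F)`, which is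
the usual `Proj` of the diagonal subring since `𝒪(1, 1)` is ample: it is covered by the six affine
charts `tᵢ ≠ 0`, `xⱼ ≠ 0` (`x = (u, v, w)`), the basic opens of `tᵢ xⱼ`, on which it is
`z² = F` with `tᵢ = xⱼ = 1`. -/
def doubleCover (F : BranchForm) : Scheme.{0} :=
  Proj (coverGrading F)

/-- The structure morphism of the double cover over `Spec ℝ`. -/
def doubleCover.structureMap (F : BranchForm) : doubleCover F ⟶ Spec (CommRingCat.of ℝ) :=
  Proj.toSpecZero (coverGrading F) ≫
    Spec.map (CommRingCat.ofHom (algebraMap ℝ (coverGrading F 0)))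

/-! ### The quartic, its double cover and the quadratic twist -/

theorem isWeightedHomogeneous_rename_inr (Q : TernaryQuadraticForm) :
    IsWeightedHomogeneous baseBidegree
      (rename Sum.inr (Q : MvPolynomial (Fin 3) ℝ) : MvPolynomial BaseVar ℝ) (0, 2) := by
  refine isWeightedHomogeneous_rename fun d hd => ?_
  have h : Finsupp.weight 1 d = 2 := Q.2 hd
  rw [Finsupp.weight_apply] at h ⊢
  have h1 : (d.sum fun i c => c • (baseBidegree ∘ Sum.inr) i) =
      (d.sum fun i c => c • (1 : Fin 3 → ℕ) i) • ((0, 1) : ℕ × ℕ) := by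
    simp only [Finsupp.sum, Finset.sum_smul]
    exact Finset.sum_congr rfl fun i _ => by simp [baseBidegree]
  rw [h1, h]
  rfl

theorem isWeightedHomogeneous_t_mul_t (i j : Fin 2) :
    IsWeightedHomogeneous baseBidegree
      (X (Sum.inl i) * X (Sum.inl j) : MvPolynomial BaseVar ℝ) (2, 0) :=
  (isWeightedHomogeneous_X ℝ baseBidegree (Sum.inl i)).mul
    (isWeightedHomogeneous_X ℝ baseBidegree (Sum.inl j))

/-- The form `t₀² Q₁ + 2 t₀ t₁ Q₂ + t₁² Q₃`. -/
def branchForm (Q₁ Q₂ Q₃ : TernaryQuadraticForm) : BranchForm :=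
  ⟨X (Sum.inl 0) ^ 2 * rename Sum.inr Q₁.1
      + 2 * X (Sum.inl 0) * X (Sum.inl 1) * rename Sum.inr Q₂.1
      + X (Sum.inl 1) ^ 2 * rename Sum.inr Q₃.1, by
    have h (i j) (Q : TernaryQuadraticForm) :=
      (isWeightedHomogeneous_t_mul_t i j).mul (isWeightedHomogeneous_rename_inr Q)
    refine (congrArg (· ∈ weightedHomogeneousSubmodule ℝ baseBidegree (2, 2)) ?_).mp
      (((h 0 0 Q₁).add ((h 0 1 Q₂).add (h 0 1 Q₂))).add (h 1 1 Q₃))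
    ring⟩

/-- The form `-t₀² Q₁ + 2 t₀ t₁ Q₂ - t₁² Q₃`. -/
def twistedBranchForm (Q₁ Q₂ Q₃ : TernaryQuadraticForm) : BranchForm :=
  ⟨-X (Sum.inl 0) ^ 2 * rename Sum.inr Q₁.1
      + 2 * X (Sum.inl 0) * X (Sum.inl 1) * rename Sum.inr Q₂.1
      - X (Sum.inl 1) ^ 2 * rename Sum.inr Q₃.1, by
    have h (i j) (Q : TernaryQuadraticForm) :=
      (isWeightedHomogeneous_t_mul_t i j).mul (isWeightedHomogeneous_rename_inr Q)
    refine (congrArg (· ∈ weightedHomogeneousSubmodule ℝ baseBidegree (2, 2)) ?_).mp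
      (((h 0 0 Q₁).neg.add ((h 0 1 Q₂).add (h 0 1 Q₂))).sub (h 1 1 Q₃))
    ring⟩

/-- The quartic form `Q₁ Q₃ - Q₂²` defining the plane curve `Δ`. -/
def quartic (Q₁ Q₂ Q₃ : TernaryQuadraticForm) : MvPolynomial (Fin 3) ℝ :=
  Q₁.1 * Q₃.1 - Q₂.1 ^ 2

/-- The plane curve `f = 0` over `ℝ` (`f` homogeneous) is smooth: it has no complex point at which
all the partial derivatives of `f` vanish. -/
def IsSmoothPlaneCurve (f : MvPolynomial (Fin 3) ℝ) : Prop :=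
  ∀ a : Fin 3 → ℂ, a ≠ 0 → aeval a f = 0 → ∃ i, aeval a (pderiv i f) ≠ 0

/-- The real points of the plane curve `f = 0`, for `f` homogeneous. -/
def realPoints (f : MvPolynomial (Fin 3) ℝ) : Set (Projectivization ℝ (Fin 3 → ℝ)) :=
  {p | eval p.rep f = 0}

/-- A threefold over `ℝ` is rational (over `ℝ`) if it is birational over `ℝ` to `𝔸³`. -/
def IsRationalThreefold {W : Scheme.{0}} (sW : W ⟶ Spec (CommRingCat.of ℝ)) : Prop :=
  Scheme.BirationalOver sW
    (𝔸(Fin 3; Spec (CommRingCat.of ℝ)) ↘ Spec (CommRingCat.of ℝ))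

end DoubleCover

end

/-!
At a real point `p` of `Δ` we have `Q₁ Q₃ = Q₂²`, and smoothness of `Δ` prevents `Q₁` and `Q₃` from
vanishing together. Hence, for one choice of the sign which distinguishes `Y` from `Y⁻`, the values
`±Q₁, Q₂, ±Q₃` at `p` are `c₀², c₀ c₁, c₁²` with `c ≠ 0`, and the branch form restricts to the
square `(c₀ t₀ + c₁ t₁)²` on `ℙ¹ × {p}`. So `z = c₀ t₀ + c₁ t₁` is a section over `p` of the quadric
surface bundle `Y → ℙ¹`. Let `τ = t₁ / t₀`, let `ξ` be the affine coordinates on `ℙ²` and let `ω` be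
that of `z`. Stereographic projection of the generic fibre `ω² = F(1, τ, ξ)` from the point defined
by the section gives `ℝ(τ, ξ, ω) = ℝ(τ, μ)` with two coordinates `μ`. As the function field of `Y`
has transcendence degree `3`, it is purely transcendental.
-/

noncomputable section

namespace DoubleCover

universe u

section AffineModels

theorem isDominant_specMap_of_injective {R S : Type u} [CommRing R] [CommRing S] {φ : R →+* S}
    (h : Function.Injective φ) : IsDominant (Spec.map (CommRingCat.ofHom φ)) := by
  refine ⟨(PrimeSpectrum.denseRange_comap_iff_ker_le_nilRadical φ).2 ?_⟩
  rw [(RingHom.injective_iff_ker_eq_bot φ).1 h]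
  exact bot_le

/-- The structure morphism of `Spec A` over `Spec R`, for an `R`-algebra `A`. -/
abbrev specOver (R A : Type u) [CommRing R] [CommRing A] [Algebra R A] :
    Spec (CommRingCat.of A) ⟶ Spec (CommRingCat.of R) :=
  Spec.map (CommRingCat.ofHom (algebraMap R A))

theorem birationalOver_specOver_of_algEquiv {R A B : Type u} [CommRing R] [CommRing A]
    [CommRing B] [Algebra R A] [Algebra R B] (e : A ≃ₐ[R] B) :
    Scheme.BirationalOver (specOver R A) (specOver R B) := by
  refine (Scheme.Hom.birationalOver (Spec.map e.toRingEquiv.toCommRingCatIso.hom) _ _ ?_).symm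
  rw [← Spec.map_comp]
  congr 1
  ext r
  exact e.commutes r

theorem birationalOver_specOver_of_isLocalization_away {R A B : Type u} [CommRing R] [CommRing A]
    [IsDomain A] [CommRing B] [Algebra R A] [Algebra R B] [Algebra A B] [IsScalarTower R A B]
    {f : A} (hf : f ≠ 0) [IsLocalization.Away f B] :
    Scheme.BirationalOver (specOver R A) (specOver R B) := by
  have : IsOpenImmersion (specOver A B) := IsOpenImmersion.of_isLocalization f
  have : IsDominant (specOver A B) := isDominant_specMap_of_injective
    (IsLocalization.injective B (powers_le_nonZeroDivisors_of_noZeroDivisors hf))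
  refine (Scheme.Hom.birationalOver (specOver A B) _ _ ?_).symm
  rw [← Spec.map_comp, ← CommRingCat.ofHom_comp, ← IsScalarTower.algebraMap_eq]

theorem birationalOver_adjoin_affineSpace {R A σ : Type u} [CommRing R] [CommRing A] [Algebra R A]
    {x : σ → A} (hx : AlgebraicIndependent R x) :
    Scheme.BirationalOver (specOver R (Algebra.adjoin R (Set.range x)))
      (𝔸(σ; Spec (CommRingCat.of R)) ↘ Spec (CommRingCat.of R)) := by
  refine (birationalOver_specOver_of_algEquiv hx.aevalEquiv.symm).trans ?_
  exact Scheme.Hom.birationalOver (AffineSpace.SpecIso σ (CommRingCat.of R)).inv _ _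
    (AffineSpace.SpecIso_inv_over (CommRingCat.of R))

variable {k K : Type u} [Field k] [Field K] [Algebra k K]

/-- The localization `A[1/f]` of a subalgebra `A` of a field, for `f ∈ A`. -/
def invAdjoin (A : Subalgebra k K) (f : A) : Subalgebra k K where
  carrier := {x | ∃ n : ℕ, (f : K) ^ n * x ∈ A}
  mul_mem' := by
    rintro x y ⟨m, hm⟩ ⟨n, hn⟩
    refine ⟨m + n, ?_⟩
    convert A.mul_mem hm hn using 1
    ring
  add_mem' := by
    rintro x y ⟨m, hm⟩ ⟨n, hn⟩
    refine ⟨m + n, ?_⟩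
    convert A.add_mem (A.mul_mem (pow_mem f.2 n) hm) (A.mul_mem (pow_mem f.2 m) hn) using 1
    ring
  algebraMap_mem' r := ⟨0, by simpa only [pow_zero, one_mul] using A.algebraMap_mem r⟩

variable {A C : Subalgebra k K}

theorem le_invAdjoin (f : A) : A ≤ invAdjoin A f := fun x hx => ⟨0, by simpa using hx⟩

theorem birationalOver_invAdjoin {f : A} (hf : f ≠ 0) :
    Scheme.BirationalOver (specOver k A) (specOver k (invAdjoin A f)) := by
  have hf' : (f : K) ≠ 0 := fun h => hf (Subtype.ext h)
  let ι := Subalgebra.inclusion (le_invAdjoin f)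
  let := ι.toAlgebra
  have : IsScalarTower k A (invAdjoin A f) := IsScalarTower.of_algHom ι
  have : IsLocalization.Away f (invAdjoin A f) := by
    refine IsLocalization.Away.mk f ?_ ?_ ?_
    · refine .of_mul_eq_one ⟨(f : K)⁻¹, 1, ?_⟩ (Subtype.ext (mul_inv_cancel₀ hf'))
      simp only [pow_one, mul_inv_cancel₀ hf', A.one_mem]
    · rintro ⟨x, n, hn⟩
      exact ⟨n, ⟨_, hn⟩, Subtype.ext (mul_comm x _)⟩
    · intro a b h
      exact ⟨0, by simpa using Subalgebra.inclusion_injective _ h⟩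
  exact birationalOver_specOver_of_isLocalization_away hf

theorem exists_le_invAdjoin (hC : C.FG)
    (h : C ≤ (IntermediateField.adjoin k (A : Set K)).toSubalgebra) :
    ∃ f : A, f ≠ 0 ∧ C ≤ invAdjoin A f := by
  classical
  have exists_denom (c : K) (hc : c ∈ C) : ∃ d ∈ A, d ≠ 0 ∧ d * c ∈ A := by
    obtain ⟨r, hr, s, hs, rfl⟩ := IntermediateField.mem_adjoin_iff_div.1 (h hc)
    rw [Algebra.adjoin_eq] at hr hs
    rcases eq_or_ne s 0 with rfl | hs0
    · exact ⟨1, A.one_mem, one_ne_zero, by simp⟩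
    · exact ⟨s, hs, hs0, by rwa [mul_div_cancel₀ _ hs0]⟩
  obtain ⟨s, rfl⟩ := hC
  choose! d hdA hd0 hd using fun c hc => exists_denom c (Algebra.subset_adjoin hc)
  refine ⟨∏ c ∈ s.attach, ⟨d c, hdA c c.2⟩, ?_, Algebra.adjoin_le fun c hc => ⟨1, ?_⟩⟩
  · exact Finset.prod_ne_zero_iff.2 fun c _ h0 => hd0 c c.2 (congrArg Subtype.val h0)
  · rw [pow_one, ← Finset.mul_prod_erase _ _ (Finset.mem_attach s ⟨c, hc⟩), A.coe_mul,
      mul_right_comm]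
    exact A.mul_mem (hd c hc) (Subtype.property _)

theorem birationalOver_of_le (hAC : A ≤ C) (hC : C.FG)
    (h : C ≤ (IntermediateField.adjoin k (A : Set K)).toSubalgebra) :
    Scheme.BirationalOver (specOver k A) (specOver k C) := by
  obtain ⟨f, hf, hCf⟩ := exists_le_invAdjoin hC h
  let g : C := Subalgebra.inclusion hAC f
  have hg : g ≠ 0 := fun h0 =>
    hf (Subalgebra.inclusion_injective hAC (h0.trans (map_zero _).symm))
  have heq : invAdjoin A f = invAdjoin C g := by
    refine le_antisymm (fun x ⟨n, hn⟩ => ⟨n, hAC hn⟩) fun x ⟨n, hn⟩ => ?_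
    obtain ⟨m, hm⟩ := hCf hn
    refine ⟨m + n, ?_⟩
    rw [pow_add, mul_assoc]
    exact hm
  have hA := birationalOver_invAdjoin hf
  rw [heq] at hA
  exact hA.trans (birationalOver_invAdjoin hg).symm

theorem birationalOver_adjoin_of_adjoin_eq {S T : Set K} (hS : S.Finite) (hT : T.Finite)
    (h : IntermediateField.adjoin k S = IntermediateField.adjoin k T) :
    Scheme.BirationalOver (specOver k (Algebra.adjoin k S)) (specOver k (Algebra.adjoin k T)) := by
  have birationalOver_union {U : Set K} (hU : U ⊆ S ∪ T)
      (hST : S ∪ T ⊆ IntermediateField.adjoin k U) :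
      Scheme.BirationalOver (specOver k (Algebra.adjoin k U))
        (specOver k (Algebra.adjoin k (S ∪ T))) :=
    birationalOver_of_le (Algebra.adjoin_mono hU)
      (Subalgebra.fg_def.2 ⟨_, hS.union hT, rfl⟩)
      (Algebra.adjoin_le (hST.trans (IntermediateField.adjoin.mono k _ _ Algebra.subset_adjoin)))
  have hS' := IntermediateField.subset_adjoin k S
  have hT' := IntermediateField.subset_adjoin k T
  refine (birationalOver_union Set.subset_union_left (Set.union_subset hS' ?_)).trans
    (birationalOver_union Set.subset_union_right (Set.union_subset ?_ hT')).symm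
  · rwa [h]
  · rwa [← h]

end AffineModels

section ProjectiveModels

open HomogeneousLocalization

variable {R A : Type u} [CommRing R] [CommRing A] [Algebra R A] (𝒜 : ℕ → Submodule R A)
  [GradedAlgebra 𝒜] {f : A} {m : ℕ}

theorem dense_basicOpen [IsDomain A] (hf : f ∈ 𝒜 m) (hm : 0 < m) (h0 : f ≠ 0) :
    Dense (Proj.basicOpen 𝒜 f : Set (Proj 𝒜)) := by
  have hirr : ¬ HomogeneousIdeal.irrelevant 𝒜 ≤ ⊥ := fun h => by
    have : f ∈ HomogeneousIdeal.irrelevant 𝒜 := by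
      rw [HomogeneousIdeal.mem_irrelevant_iff, GradedRing.proj_apply,
        DirectSum.decompose_of_mem_ne 𝒜 hf hm.ne']
    exact h0 (h this)
  let η : Proj 𝒜 := (⟨⊥, Ideal.isPrime_bot, hirr⟩ : ProjectiveSpectrum 𝒜)
  have hη (g : A) (hg : g ≠ 0) : η ∈ Proj.basicOpen 𝒜 g := fun h => hg h
  refine dense_iff_inter_open.2 fun U hU ⟨x, hx⟩ => ⟨η, ?_, hη f h0⟩
  obtain ⟨V, ⟨-, ⟨g, rfl⟩, rfl⟩, hxV, hVU⟩ :=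
    (Proj.isBasis_basicOpen 𝒜).exists_subset_of_mem_open hx hU
  refine hVU (hη g fun hg => ?_)
  rw [hg, Proj.basicOpen_zero] at hxV
  exact hxV

theorem isDominant_awayι [IsDomain A] (hf : f ∈ 𝒜 m) (hm : 0 < m) (h0 : f ≠ 0) :
    IsDominant (Proj.awayι 𝒜 f hf hm) := by
  refine ⟨?_⟩
  have := dense_basicOpen 𝒜 hf hm h0
  rw [← Proj.opensRange_awayι 𝒜 f hf hm] at this
  exact this

variable {𝒜} {K : Type u} [Field K] [Algebra R K] (φ : A →ₐ[R] K)

/-- The map from the degree zero part of `A[1/f]` to a field `K` induced by a map `A → K` which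
does not kill `f`. -/
def awayToField (hφf : φ f ≠ 0) : Away 𝒜 f →+* K :=
  (Localization.awayLift φ.toRingHom f (Ne.isUnit hφf)).comp
    (algebraMap (Away 𝒜 f) (Localization.Away f))

theorem awayToField_mk (hφf : φ f ≠ 0) (hf : f ∈ 𝒜 m) (n : ℕ) (a : A) (ha : a ∈ 𝒜 (n • m)) :
    awayToField φ hφf (Away.mk 𝒜 hf n a ha) = φ a / φ f ^ n := by
  rw [div_eq_mul_inv, ← inv_pow]
  exact Localization.awayLift_mk φ.toRingHom f a _ (mul_inv_cancel₀ hφf) n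

theorem awayToField_algebraMap (hφf : φ f ≠ 0) (r : R) :
    awayToField (𝒜 := 𝒜) φ hφf (fromZeroRingHom 𝒜 _ (algebraMap R (𝒜 0) r)) =
      algebraMap R K r := by
  have h : algebraMap (Away 𝒜 f) (Localization.Away f)
      (fromZeroRingHom 𝒜 _ (algebraMap R (𝒜 0) r)) = algebraMap A _ (algebraMap R A r) :=
    Localization.mk_one_eq_algebraMap _
  rw [awayToField, RingHom.comp_apply, h, IsLocalization.Away.lift_eq]
  exact φ.commutes r

theorem awayToField_injective (hφ : Function.Injective φ) (hφf : φ f ≠ 0) (hf : f ∈ 𝒜 m) :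
    Function.Injective (awayToField (𝒜 := 𝒜) φ hφf) := by
  refine (injective_iff_map_eq_zero _).2 fun w hw => ?_
  obtain ⟨n, a, ha, rfl⟩ := Away.mk_surjective 𝒜 hf w
  rw [awayToField_mk, div_eq_zero_iff, or_iff_left (pow_ne_zero n hφf),
    map_eq_zero_iff φ hφ] at hw
  subst hw
  exact mk_eq_zero_of_num _ rfl

theorem birationalOver_proj [IsDomain A] (hφ : Function.Injective φ) (hf : f ∈ 𝒜 m) (hm : 0 < m)
    (h0 : f ≠ 0) {T : Set K} (hT : ∀ x ∈ T, ∃ n, ∃ a ∈ 𝒜 (n • m), φ a / φ f ^ n = x)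
    (hadjoin : ∀ n, ∀ a ∈ 𝒜 (n • m), φ a / φ f ^ n ∈ Algebra.adjoin R T) :
    Scheme.BirationalOver
      (Proj.toSpecZero 𝒜 ≫ Spec.map (CommRingCat.ofHom (algebraMap R (𝒜 0))))
      (specOver R (Algebra.adjoin R T)) := by
  have hφf : φ f ≠ 0 := (map_ne_zero_iff φ hφ).2 h0
  let ψ : Away 𝒜 f →+* Algebra.adjoin R T := (awayToField φ hφf).codRestrict _ fun w => by
    obtain ⟨n, a, ha, rfl⟩ := Away.mk_surjective 𝒜 hf w
    rw [awayToField_mk]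
    exact hadjoin n a ha
  have hψ_surj : Function.Surjective ψ := by
    have exists_preimage : ∀ x ∈ Algebra.adjoin R T, x ∈ (awayToField (𝒜 := 𝒜) φ hφf).range := by
      refine fun x hx => Algebra.adjoin_induction (fun x hx => ?_)
        (fun r => ⟨_, awayToField_algebraMap φ hφf r⟩) (fun _ _ _ _ => add_mem)
        (fun _ _ _ _ => mul_mem) hx
      obtain ⟨n, a, ha, rfl⟩ := hT x hx
      exact ⟨_, awayToField_mk φ hφf hf n a ha⟩
    intro x
    obtain ⟨w, hw⟩ := exists_preimage x x.2
    exact ⟨w, Subtype.ext hw⟩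
  have hψ : Function.Bijective ψ :=
    ⟨fun _ _ h => awayToField_injective φ hφ hφf hf (congrArg Subtype.val h), hψ_surj⟩
  have : IsDominant (Proj.awayι 𝒜 f hf hm) := isDominant_awayι 𝒜 hf hm h0
  refine (Scheme.Hom.birationalOver
    (Spec.map (RingEquiv.ofBijective ψ hψ).toCommRingCatIso.hom ≫ Proj.awayι 𝒜 f hf hm) _ _ ?_).symm
  rw [Category.assoc, Proj.awayι_toSpecZero_assoc, ← Spec.map_comp, ← Spec.map_comp]
  congr 1
  ext r
  exact awayToField_algebraMap (𝒜 := 𝒜) φ hφf r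

end ProjectiveModels

section FunctionField

/-- The bigraded ring `ℝ[t₀, t₁, u, v, w, z] / (z² - F)` of multihomogeneous coordinates on the
double cover. -/
abbrev CoverRing (F : BranchForm) : Type := MvPolynomial Var ℝ ⧸ coverIdeal F

theorem optionEquivLeft_rename_some {R σ : Type*} [CommRing R] (P : MvPolynomial σ R) :
    optionEquivLeft R σ (rename some P) = Polynomial.C P := by
  have h : (optionEquivLeft R σ).toAlgHom.comp (rename some) = Polynomial.CAlgHom := by
    ext i
    simp
  exact congrArg (fun ψ => ψ P) h

theorem optionEquivLeft_cover (F : MvPolynomial BaseVar ℝ) :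
    optionEquivLeft ℝ BaseVar (X none ^ 2 - rename some F) =
      Polynomial.X ^ 2 - Polynomial.C F := by
  rw [map_sub, map_pow, optionEquivLeft_X_none, optionEquivLeft_rename_some]

theorem irreducible_X_sq_sub_C {A : Type*} [CommRing A] [IsDomain A] {a : A} (ha : ¬ IsSquare a) :
    Irreducible (Polynomial.X ^ 2 - Polynomial.C a) := by
  have hdeg : (Polynomial.X ^ 2 - Polynomial.C a).natDegree = 2 := Polynomial.natDegree_X_pow_sub_C
  rw [(Polynomial.monic_X_pow_sub_C a two_ne_zero).irreducible_iff_roots_eq_zero_of_degree_le_three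
    hdeg.ge (by omega)]
  refine Multiset.eq_zero_of_forall_notMem fun b hb => ha ⟨b, ?_⟩
  have hroot := (Polynomial.mem_roots'.1 hb).2
  rw [Polynomial.IsRoot, Polynomial.eval_sub, Polynomial.eval_pow, Polynomial.eval_X,
    Polynomial.eval_C, sub_eq_zero] at hroot
  rw [← hroot, pow_two]

theorem isSquare_of_sq_eq_aeval {k K σ : Type*} [Field k] [Field K] [Algebra k K] {x : σ → K}
    (hx : AlgebraicIndependent k x) {z : K} (hz : z ∈ IntermediateField.adjoin k (Set.range x))
    {P : MvPolynomial σ k} (h : z ^ 2 = aeval x P) : IsSquare P := by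
  obtain ⟨r, s, rfl⟩ := (IntermediateField.mem_adjoin_range_iff k x z).1 hz
  rcases eq_or_ne (aeval x s) 0 with hs | hs
  · rw [hs, div_zero, zero_pow two_ne_zero] at h
    rw [hx.eq_zero_of_aeval_eq_zero P h.symm]
    exact IsSquare.zero
  rw [div_pow, div_eq_iff (pow_ne_zero 2 hs)] at h
  have hrs : r ^ 2 = P * s ^ 2 :=
    algebraicIndependent_iff_injective_aeval.1 hx (by simpa only [map_mul, map_pow] using h)
  obtain ⟨g, rfl⟩ : s ∣ r := (IsIntegrallyClosed.pow_dvd_pow_iff two_ne_zero).1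
    (Dvd.intro_left P hrs.symm)
  have hs0 : s ≠ 0 := fun h0 => hs (by rw [h0, map_zero])
  refine ⟨g, mul_right_cancel₀ (pow_ne_zero 2 hs0) (hrs.symm.trans ?_)⟩
  ring

variable {F : BranchForm}

theorem isDomain_coverRing (hF : ¬ IsSquare F.1) : IsDomain (CoverRing F) := by
  have hprime : Prime (X none ^ 2 - rename some F.1 : MvPolynomial Var ℝ) := by
    rw [← MulEquiv.prime_iff (optionEquivLeft ℝ BaseVar), optionEquivLeft_cover]
    exact (irreducible_X_sq_sub_C hF).prime
  have : (coverIdeal F).IsPrime := (Ideal.span_singleton_prime hprime.ne_zero).2 hprime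
  exact Ideal.Quotient.isDomain _

theorem eq_zero_of_rename_some_mem_coverIdeal {P : MvPolynomial BaseVar ℝ}
    (hP : rename some P ∈ coverIdeal F) : P = 0 := by
  rw [coverIdeal, Ideal.mem_span_singleton, ← map_dvd_iff (optionEquivLeft ℝ BaseVar),
    optionEquivLeft_cover, optionEquivLeft_rename_some] at hP
  by_contra hP0
  refine (Polynomial.monic_X_pow_sub_C F.1 two_ne_zero).not_dvd_of_natDegree_lt
    (Polynomial.C_ne_zero.2 hP0) ?_ hP
  rw [Polynomial.natDegree_C, Polynomial.natDegree_X_pow_sub_C]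
  exact two_pos

variable (F) (K : Type) [Field K] [Algebra ℝ K] [Algebra (CoverRing F) K]

/-- The coordinates `t₀, t₁, u, v, w, z` in the function field `K` of the coordinate ring of the
double cover. -/
def genericCoord (v : Var) : K := algebraMap (CoverRing F) K (Ideal.Quotient.mk _ (X v))

variable [IsScalarTower ℝ (CoverRing F) K]

theorem aeval_genericCoord (P : MvPolynomial Var ℝ) :
    aeval (genericCoord F K) P = algebraMap (CoverRing F) K (Ideal.Quotient.mk _ P) := by
  let ψ : MvPolynomial Var ℝ →ₐ[ℝ] K :=
    (IsScalarTower.toAlgHom ℝ (CoverRing F) K).comp (Ideal.Quotient.mkₐ ℝ _)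
  exact congrArg (fun θ : MvPolynomial Var ℝ →ₐ[ℝ] K => θ P) (aeval_unique ψ).symm

theorem genericCoord_none_sq :
    genericCoord F K none ^ 2 = aeval (genericCoord F K ∘ some) F.1 := by
  have h : aeval (genericCoord F K) (X none ^ 2 - rename some F.1) = 0 := by
    rw [aeval_genericCoord, (Ideal.Quotient.eq_zero_iff_mem (I := coverIdeal F)).2
      (Ideal.mem_span_singleton_self _), map_zero]
  rwa [map_sub, map_pow, aeval_X, aeval_rename, sub_eq_zero] at h

variable [IsFractionRing (CoverRing F) K]

theorem algebraicIndependent_genericCoord :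
    AlgebraicIndependent ℝ (genericCoord F K ∘ some) := by
  rw [algebraicIndependent_iff]
  intro P hP
  have h : aeval (genericCoord F K) (rename some P) = 0 := by rwa [aeval_rename]
  rw [aeval_genericCoord, FaithfulSMul.algebraMap_eq_zero_iff, Ideal.Quotient.eq_zero_iff_mem] at h
  exact eq_zero_of_rename_some_mem_coverIdeal h

theorem adjoin_genericCoord :
    IntermediateField.adjoin ℝ (Set.range (genericCoord F K)) = ⊤ := by
  have aeval_mem (P : MvPolynomial Var ℝ) :
      aeval (genericCoord F K) P ∈ IntermediateField.adjoin ℝ (Set.range (genericCoord F K)) :=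
    IntermediateField.algebra_adjoin_le_adjoin _ _
      ((Algebra.adjoin_range_eq_range_aeval ℝ (genericCoord F K)).ge ⟨P, rfl⟩)
  refine eq_top_iff.2 fun x _ => ?_
  obtain ⟨a, b, -, rfl⟩ := IsFractionRing.div_surjective (A := CoverRing F) x
  obtain ⟨P, rfl⟩ := Ideal.Quotient.mk_surjective a
  obtain ⟨R, rfl⟩ := Ideal.Quotient.mk_surjective b
  rw [← aeval_genericCoord, ← aeval_genericCoord]
  exact div_mem (aeval_mem P) (aeval_mem R)

theorem genericCoord_none_notMem (hF : ¬ IsSquare F.1) :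
    genericCoord F K none ∉
      IntermediateField.adjoin ℝ (Set.range (genericCoord F K ∘ some)) :=
  fun h => hF (isSquare_of_sq_eq_aeval (algebraicIndependent_genericCoord F K) h
    (genericCoord_none_sq F K))

end FunctionField

section AffineChart

theorem aeval_addChar_mul {R S σ M : Type*} [CommSemiring R] [CommSemiring S] [Algebra R S]
    [AddCommMonoid M] (χ : AddChar M S) (x : σ → S) {w : σ → M} {m : M} {P : MvPolynomial σ R}
    (hP : IsWeightedHomogeneous w P m) :
    aeval (fun i => χ (w i) * x i) P = χ m * aeval x P := by
  rw [aeval_def, aeval_def, eval₂_eq, eval₂_eq, Finset.mul_sum]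
  refine Finset.sum_congr rfl fun d hd => ?_
  have hχ : ∏ i ∈ d.support, χ (w i) ^ d i = χ m := by
    simp_rw [← AddChar.map_nsmul_eq_pow, ← hP (mem_support_iff.1 hd), Finsupp.weight_apply]
    exact (map_prod χ.toMonoidHom (fun i => .ofAdd (d i • w i)) d.support).symm
  simp_rw [mul_pow]
  rw [Finset.prod_mul_distrib, hχ, mul_left_comm]

/-- The character `(a, b) ↦ s⁻ᵃ t⁻ᵇ`, which describes how dividing the coordinates on `ℙ¹` by `s`
and those on `ℙ²` by `t` acts on forms of bidegree `(a, b)`. -/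
def dehomogenization {K : Type*} [Field K] (s t : K) : AddChar (ℕ × ℕ) K where
  toFun d := (s ^ d.1 * t ^ d.2)⁻¹
  map_zero_eq_one' := by simp
  map_add_eq_mul' d e := by
    rw [← mul_inv, Prod.fst_add, Prod.snd_add, pow_add, pow_add]
    ring

variable (F : BranchForm) (K : Type) [Field K] [Algebra ℝ K] [Algebra (CoverRing F) K] (j : Fin 3)

/-- The coordinates on the chart `t₀ xⱼ ≠ 0` of the double cover, as elements of its function
field. Those of `t₀` and `xⱼ` are `1`. -/
def affineCoord (v : Var) : K :=
  dehomogenization (genericCoord F K (some (.inl 0))) (genericCoord F K (some (.inr j)))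
    (bidegree v) * genericCoord F K v

variable [IsScalarTower ℝ (CoverRing F) K]

theorem affineCoord_none_sq :
    affineCoord F K j none ^ 2 = aeval (affineCoord F K j ∘ some) F.1 := by
  rw [affineCoord, mul_pow, ← AddChar.map_nsmul_eq_pow, genericCoord_none_sq]
  exact (aeval_addChar_mul _ _ F.2).symm

theorem aeval_affineCoord {P : MvPolynomial Var ℝ} {n : ℕ}
    (hP : IsWeightedHomogeneous bidegree P (n, n)) :
    aeval (affineCoord F K j) P = algebraMap (CoverRing F) K (Ideal.Quotient.mk _ P) /
      algebraMap (CoverRing F) K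
        (Ideal.Quotient.mk _ (X (some (.inl 0)) * X (some (.inr j)))) ^ n := by
  rw [← aeval_genericCoord, div_eq_inv_mul, map_mul, map_mul, mul_pow]
  exact aeval_addChar_mul _ _ hP

variable [IsFractionRing (CoverRing F) K]

theorem genericCoord_some_ne_zero (i : BaseVar) : genericCoord F K (some i) ≠ 0 :=
  (algebraicIndependent_genericCoord F K).ne_zero i

theorem affineCoord_inl_zero : affineCoord F K j (some (.inl 0)) = 1 := by
  have := genericCoord_some_ne_zero F K (.inl 0)
  simp [affineCoord, dehomogenization, bidegree, baseBidegree, this]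

theorem affineCoord_inr : affineCoord F K j (some (.inr j)) = 1 := by
  have := genericCoord_some_ne_zero F K (.inr j)
  simp [affineCoord, dehomogenization, bidegree, baseBidegree, this]

theorem genericCoord_eq (v : Var) :
    genericCoord F K v = genericCoord F K (some (.inl 0)) ^ (bidegree v).1 *
      genericCoord F K (some (.inr j)) ^ (bidegree v).2 * affineCoord F K j v :=
  (mul_inv_cancel_left₀ (mul_ne_zero (pow_ne_zero _ (genericCoord_some_ne_zero F K _))
    (pow_ne_zero _ (genericCoord_some_ne_zero F K _))) _).symm

theorem exists_aeval_affineCoord_eq (v : Var) :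
    ∃ P : MvPolynomial Var ℝ, IsWeightedHomogeneous bidegree P (1, 1) ∧
      aeval (affineCoord F K j) P = affineCoord F K j v := by
  have hX (v : Var) := isWeightedHomogeneous_X ℝ bidegree v
  rcases v with _ | i | k
  · exact ⟨X none, hX none, aeval_X _ _⟩
  · refine ⟨X (some (.inl i)) * X (some (.inr j)), (hX _).mul (hX _), ?_⟩
    rw [map_mul, aeval_X, aeval_X, affineCoord_inr, mul_one]
  · refine ⟨X (some (.inl 0)) * X (some (.inr k)), (hX _).mul (hX _), ?_⟩
    rw [map_mul, aeval_X, aeval_X, affineCoord_inl_zero, one_mul]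

theorem birationalOver_doubleCover :
    Scheme.BirationalOver (doubleCover.structureMap F)
      (specOver ℝ (Algebra.adjoin ℝ (Set.range (affineCoord F K j)))) := by
  have hinj : Function.Injective (algebraMap (CoverRing F) K) := IsFractionRing.injective _ _
  have : IsDomain (CoverRing F) := hinj.isDomain
  have homogeneous_den : IsWeightedHomogeneous bidegree
      (X (some (.inl 0)) * X (some (.inr j)) : MvPolynomial Var ℝ) (1, 1) :=
    (isWeightedHomogeneous_X ℝ bidegree _).mul (isWeightedHomogeneous_X ℝ bidegree _)
  have mem_diagonal {P : MvPolynomial Var ℝ} (hP : IsWeightedHomogeneous bidegree P (1, 1)) :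
      Ideal.Quotient.mk (coverIdeal F) P ∈ diagonal (coverBigrading F) :=
    Submodule.mem_iSup_of_mem 1 ⟨P, hP, rfl⟩
  let den : diagonal (coverBigrading F) := ⟨_, mem_diagonal homogeneous_den⟩
  have hden : den ≠ 0 := by
    refine fun h => mul_ne_zero (genericCoord_some_ne_zero F K (.inl 0))
      (genericCoord_some_ne_zero F K (.inr j)) ?_
    rw [genericCoord, genericCoord, ← map_mul, ← map_mul]
    exact (congrArg (algebraMap _ K) (congrArg Subtype.val h)).trans (map_zero _)
  refine birationalOver_proj (𝒜 := coverGrading F) (f := den) (m := 1)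
    ((IsScalarTower.toAlgHom ℝ (CoverRing F) K).comp (diagonal (coverBigrading F)).val)
    (hinj.comp Subtype.val_injective) ⟨_, homogeneous_den, rfl⟩ one_pos hden ?_ ?_
  · rintro _ ⟨v, rfl⟩
    obtain ⟨P, hP, hPv⟩ := exists_aeval_affineCoord_eq F K j v
    exact ⟨1, ⟨_, mem_diagonal hP⟩, ⟨P, hP, rfl⟩, (aeval_affineCoord F K j hP).symm.trans hPv⟩
  · rintro n ⟨_, ha⟩ ⟨P, hP, rfl⟩
    have hP' : IsWeightedHomogeneous bidegree P (n, n) := by rwa [smul_eq_mul, mul_one] at hP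
    rw [Algebra.adjoin_range_eq_range_aeval]
    exact ⟨P, aeval_affineCoord F K j hP'⟩

end AffineChart

section RationalityCriterion

theorem algebraicIndependent_of_adjoin_eq_top {k K ι ι' : Type u} [Field k] [Field K] [Algebra k K]
    [Finite ι'] {x : ι → K} (hx : AlgebraicIndependent k x) {y : ι' → K}
    (hy : IntermediateField.adjoin k (Set.range y) = ⊤) (hcard : Cardinal.mk ι' ≤ Cardinal.mk ι) :
    AlgebraicIndependent k y := by
  have : Algebra.IsAlgebraic (Algebra.adjoin k (Set.range y)) K := by
    rw [← IntermediateField.isAlgebraic_adjoin_iff_top, hy]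
    exact ⟨fun z => isAlgebraic_algebraMap (⟨z, trivial⟩ : (⊤ : IntermediateField k K))⟩
  exact (Algebra.IsAlgebraic.isTranscendenceBasis_of_le_trdeg_of_finite k y
    (hcard.trans hx.cardinalMk_le_trdeg)).1

variable {F : BranchForm} {K : Type} [Field K] [Algebra ℝ K] [Algebra (CoverRing F) K]
  [IsScalarTower ℝ (CoverRing F) K] [IsFractionRing (CoverRing F) K] {j : Fin 3}

theorem algebraicIndependent_of_adjoin_eq {y : Fin 3 → K}
    (hy : IntermediateField.adjoin ℝ (Set.range y) =
      IntermediateField.adjoin ℝ (Set.range (affineCoord F K j))) :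
    AlgebraicIndependent ℝ y := by
  -- Together with `t₀` and `xⱼ`, the three elements `y` generate `K`, of transcendence degree `5`.
  let y' : BaseVar → K :=
    Sum.elim ![genericCoord F K (some (.inl 0)), genericCoord F K (some (.inr j))] y
  have mem_adjoin (i : BaseVar) : y' i ∈ IntermediateField.adjoin ℝ (Set.range y') :=
    IntermediateField.subset_adjoin _ _ ⟨i, rfl⟩
  have affineCoord_mem (v : Var) :
      affineCoord F K j v ∈ IntermediateField.adjoin ℝ (Set.range y') := by
    have hle : IntermediateField.adjoin ℝ (Set.range y) ≤
        IntermediateField.adjoin ℝ (Set.range y') :=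
      IntermediateField.adjoin.mono _ _ _ (Set.range_comp_subset_range Sum.inr y')
    exact (hy.ge.trans hle) (IntermediateField.subset_adjoin _ _ ⟨v, rfl⟩)
  have genericCoord_mem (v : Var) :
      genericCoord F K v ∈ IntermediateField.adjoin ℝ (Set.range y') := by
    rw [genericCoord_eq F K j v]
    exact mul_mem (mul_mem (pow_mem (mem_adjoin (.inl 0)) _) (pow_mem (mem_adjoin (.inl 1)) _))
      (affineCoord_mem v)
  have hy' : IntermediateField.adjoin ℝ (Set.range y') = ⊤ := by
    rw [eq_top_iff, ← adjoin_genericCoord F K, IntermediateField.adjoin_le_iff]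
    rintro _ ⟨v, rfl⟩
    exact genericCoord_mem v
  exact (algebraicIndependent_of_adjoin_eq_top (algebraicIndependent_genericCoord F K) hy'
    le_rfl).comp Sum.inr Sum.inr_injective

theorem isRationalThreefold_of_adjoin_eq {y : Fin 3 → K}
    (hy : IntermediateField.adjoin ℝ (Set.range y) =
      IntermediateField.adjoin ℝ (Set.range (affineCoord F K j))) :
    IsRationalThreefold (doubleCover.structureMap F) :=
  ((birationalOver_doubleCover F K j).trans
    (birationalOver_adjoin_of_adjoin_eq (Set.finite_range y) (Set.finite_range _) hy).symm).trans
    (birationalOver_adjoin_affineSpace (algebraicIndependent_of_adjoin_eq hy))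

end RationalityCriterion

section QuadraticForms

variable {R σ : Type*} (S : Type*) [CommRing R] [CommRing S] [Algebra R S]

theorem exists_linearMap_eq_aeval {P : MvPolynomial σ R} (hP : P.IsHomogeneous 1) :
    ∃ l : (σ → S) →ₗ[S] S, ∀ v, l v = aeval v P := by
  have hspan : P ∈ Submodule.span R (Set.range X) :=
    homogeneousSubmodule_one_eq_span_X (σ := σ) (R := R) ▸ hP
  clear hP
  induction hspan using Submodule.span_induction with
  | mem P hX =>
    obtain ⟨i, rfl⟩ := hX
    exact ⟨LinearMap.proj i, fun v => (aeval_X v i).symm⟩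
  | zero => exact ⟨0, fun v => (map_zero _).symm⟩
  | add P P' _ _ hP hP' =>
    obtain ⟨l, hl⟩ := hP
    obtain ⟨l', hl'⟩ := hP'
    exact ⟨l + l', fun v => by rw [LinearMap.add_apply, hl, hl', map_add]⟩
  | smul r P _ hP =>
    obtain ⟨l, hl⟩ := hP
    exact ⟨algebraMap R S r • l, fun v => by
      rw [LinearMap.smul_apply, hl, map_smul, algebraMap_smul]⟩

theorem exists_quadraticForm_eq_aeval {P : MvPolynomial σ R} (hP : P.IsHomogeneous 2) :
    ∃ q : QuadraticForm S (σ → S), ∀ v, q v = aeval v P := by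
  have hmul : P ∈ homogeneousSubmodule σ R 1 * homogeneousSubmodule σ R 1 := by
    rwa [← pow_two, homogeneousSubmodule_one_pow]
  clear hP
  induction hmul using Submodule.mul_induction_on' with
  | mem_mul_mem L hL M hM =>
    obtain ⟨l, hl⟩ := exists_linearMap_eq_aeval S hL
    obtain ⟨m, hm⟩ := exists_linearMap_eq_aeval S hM
    exact ⟨QuadraticMap.linMulLin l m, fun v => by
      rw [QuadraticMap.linMulLin_apply, hl, hm, map_mul]⟩
  | add P _ P' _ hP hP' =>
    obtain ⟨q, hq⟩ := hP
    obtain ⟨q', hq'⟩ := hP'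
    exact ⟨q + q', fun v => by rw [add_apply, hq, hq', map_add]⟩

variable {S}

theorem aeval_branchForm [Algebra ℝ S] (Q₁ Q₂ Q₃ : TernaryQuadraticForm) (t : Fin 2 → S)
    (v : Fin 3 → S) :
    aeval (Sum.elim t v) (branchForm Q₁ Q₂ Q₃).1 =
      t 0 ^ 2 * aeval v Q₁.1 + 2 * t 0 * t 1 * aeval v Q₂.1 + t 1 ^ 2 * aeval v Q₃.1 := by
  simp [branchForm, aeval_rename]

theorem exists_quadraticForm_eq_aeval_branchForm [Algebra ℝ S] (Q₁ Q₂ Q₃ : TernaryQuadraticForm)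
    (t : Fin 2 → S) :
    ∃ q : QuadraticForm S (Fin 3 → S), ∀ v, q v = aeval (Sum.elim t v) (branchForm Q₁ Q₂ Q₃).1 := by
  obtain ⟨q₁, h₁⟩ := exists_quadraticForm_eq_aeval S Q₁.2
  obtain ⟨q₂, h₂⟩ := exists_quadraticForm_eq_aeval S Q₂.2
  obtain ⟨q₃, h₃⟩ := exists_quadraticForm_eq_aeval S Q₃.2
  refine ⟨t 0 ^ 2 • q₁ + (2 * t 0 * t 1) • q₂ + t 1 ^ 2 • q₃, fun v => ?_⟩
  rw [aeval_branchForm, ← h₁, ← h₂, ← h₃]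
  rfl

end QuadraticForms

section StereographicProjection

theorem mul_one_sub_eq_polar_sub {K V : Type*} [Field K] [AddCommGroup V] [Module K V]
    {q : QuadraticForm K V} {p v : V} {a c : K} (hc : c ≠ 0) (hp : q p = a ^ 2)
    (hv : q (p + c • v) = (a + c) ^ 2) :
    c * (1 - q v) = QuadraticMap.polar q p v - 2 * a := by
  -- On the line through the point `(p, a)` of the quadric, the equation is divisible by `c`.
  rw [QuadraticMap.map_add q, QuadraticMap.map_smul, QuadraticMap.polar_smul_right, hp,
    smul_eq_mul, smul_eq_mul] at hv
  refine mul_left_cancel₀ hc ?_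
  linear_combination - hv

variable {K ι : Type*} [Field K] {q : QuadraticForm K (ι → K)} {p : ι → K} {a ω : K}

/-- The stereographic projection of a point `(ξ, ω)` of the quadric `ω² = q` from its point
`(p, a)`, in the affine chart which measures directions by their slope with respect to `ω`. -/
def stereographic (p : ι → K) (a : K) (ξ : ι → K) (ω : K) : ι → K := (ω - a)⁻¹ • (ξ - p)

theorem add_smul_stereographic (hω : ω ≠ a) (ξ : ι → K) :
    p + (ω - a) • stereographic p a ξ ω = ξ := by
  rw [stereographic, smul_inv_smul₀ (sub_ne_zero.2 hω), add_sub_cancel]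

section Subfield

variable {L : Subfield K} (hq : ∀ v : ι → K, (∀ i, v i ∈ L) → q v ∈ L) (hp : ∀ i, p i ∈ L)
  (ha : a ∈ L) (hpa : q p = a ^ 2)

include hq hp

theorem polar_mem {v : ι → K} (hv : ∀ i, v i ∈ L) : QuadraticMap.polar q p v ∈ L :=
  sub_mem (sub_mem (hq _ fun i => add_mem (hp i) (hv i)) (hq p hp)) (hq v hv)

include ha hpa

theorem map_stereographic_ne_one [NeZero (2 : K)] {ξ : ι → K} (hξ : ∀ i, ξ i ∈ L) (ha0 : a ≠ 0)
    (hω : ω ∉ L) (hξω : q ξ = ω ^ 2) : q (stereographic p a ξ ω) ≠ 1 := by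
  intro h1
  have hωa : ω ≠ a := fun h => hω (h ▸ ha)
  have hξ' := add_smul_stereographic (p := p) hωa ξ
  have hpolar := mul_one_sub_eq_polar_sub (v := stereographic p a ξ ω) (sub_ne_zero.2 hωa) hpa
    (by rw [hξ', hξω, add_sub_cancel])
  have h2a : (ω - a) * (2 * a) = QuadraticMap.polar q p (ξ - p) := by
    rw [h1, sub_self, mul_zero, eq_comm, sub_eq_zero] at hpolar
    rw [← eq_sub_of_add_eq' hξ', QuadraticMap.polar_smul_right, hpolar, smul_eq_mul]
  rw [← eq_div_iff (mul_ne_zero two_ne_zero ha0), sub_eq_iff_eq_add] at h2a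
  rw [h2a] at hω
  exact hω (add_mem (div_mem (polar_mem hq hp fun i => sub_mem (hξ i) (hp i))
    (mul_mem (ofNat_mem L 2) ha)) ha)

theorem mem_of_stereographic_mem {ξ : ι → K} (hξ : ∀ i, stereographic p a ξ ω i ∈ L) (hωa : ω ≠ a)
    (h1 : q (stereographic p a ξ ω) ≠ 1) (hξω : q ξ = ω ^ 2) : ω ∈ L := by
  have hpolar := mul_one_sub_eq_polar_sub (v := stereographic p a ξ ω) (sub_ne_zero.2 hωa) hpa
    (by rw [add_smul_stereographic hωa, hξω, add_sub_cancel])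
  rw [← eq_div_iff (sub_ne_zero.2 h1.symm), sub_eq_iff_eq_add] at hpolar
  rw [hpolar]
  exact add_mem (div_mem (sub_mem (polar_mem hq hp hξ) (mul_mem (ofNat_mem L 2) ha))
    (sub_mem (one_mem L) (hq _ hξ))) ha

end Subfield

open IntermediateField in
theorem adjoin_stereographic {k : Type*} [Field k] [Algebra k K] [NeZero (2 : K)] {s : Set K}
    {ξ : ι → K}
    (hq : ∀ L : IntermediateField k K, s ⊆ L → ∀ v : ι → K, (∀ i, v i ∈ L) → q v ∈ L)
    (hp : ∀ i, p i ∈ adjoin k s) (ha : a ∈ adjoin k s) (ha0 : a ≠ 0) (hpa : q p = a ^ 2)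
    (hω : ω ∉ adjoin k (s ∪ Set.range ξ)) (hξω : q ξ = ω ^ 2) :
    adjoin k (s ∪ Set.range (stereographic p a ξ ω)) = adjoin k (insert ω (s ∪ Set.range ξ)) := by
  have of_s {S : Set K} {x : K} (hS : s ⊆ S) (hx : x ∈ adjoin k s) : x ∈ adjoin k S :=
    adjoin.mono k s S hS hx
  have hsξ : s ⊆ s ∪ Set.range ξ := Set.subset_union_left
  have hsμ : s ⊆ s ∪ Set.range (stereographic p a ξ ω) := Set.subset_union_left
  have hsω : s ⊆ insert ω (s ∪ Set.range ξ) := hsξ.trans (Set.subset_insert _ _)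
  have mem_range {S : Set K} {x : ι → K} (i : ι) : x i ∈ adjoin k (S ∪ Set.range x) :=
    subset_adjoin k _ (Or.inr ⟨i, rfl⟩)
  have hωa : ω ≠ a := fun h => hω (h ▸ of_s hsξ ha)
  have h1 : q (stereographic p a ξ ω) ≠ 1 :=
    map_stereographic_ne_one (L := (adjoin k (s ∪ Set.range ξ)).toSubfield)
      (hq _ (hsξ.trans (subset_adjoin k _))) (fun i => of_s hsξ (hp i)) (of_s hsξ ha) hpa
      mem_range ha0 hω hξω
  have ω_mem : ω ∈ adjoin k (s ∪ Set.range (stereographic p a ξ ω)) :=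
    mem_of_stereographic_mem (L := (adjoin k _).toSubfield)
      (hq _ (hsμ.trans (subset_adjoin k _))) (fun i => of_s hsμ (hp i)) (of_s hsμ ha) hpa
      mem_range hωa h1 hξω
  apply le_antisymm <;> rw [adjoin_le_iff]
  · refine Set.union_subset (hsω.trans (subset_adjoin k _)) (Set.range_subset_iff.2 fun i => ?_)
    have hξ : ξ i ∈ adjoin k (insert ω (s ∪ Set.range ξ)) :=
      adjoin.mono k _ _ (Set.subset_insert _ _) (mem_range i)
    exact mul_mem (inv_mem (sub_mem (subset_adjoin k _ (Set.mem_insert _ _)) (of_s hsω ha)))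
      (sub_mem hξ (of_s hsω (hp i)))
  · refine Set.insert_subset ω_mem (Set.union_subset (hsμ.trans (subset_adjoin k _))
      (Set.range_subset_iff.2 fun i => ?_))
    rw [SetLike.mem_coe, ← congrFun (add_smul_stereographic (p := p) hωa ξ) i]
    exact add_mem (of_s hsμ (hp i)) (mul_mem (sub_mem ω_mem (of_s hsμ ha)) (mem_range i))

end StereographicProjection

section Irreducibility

theorem mul_eq_sq_of_isSquare {R : Type*} [CommRing R] [IsDomain R] [NeZero (2 : R)] {α β γ : R}
    (h : IsSquare (Polynomial.C α + 2 * Polynomial.X * Polynomial.C β +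
      Polynomial.X ^ 2 * Polynomial.C γ)) :
    α * γ = β ^ 2 := by
  obtain ⟨g, hg⟩ := h
  have hdeg : g.natDegree ≤ 1 := by
    have hgg : (g * g).natDegree ≤ 2 := by
      rw [← hg]
      compute_degree
    rw [← pow_two, Polynomial.natDegree_pow] at hgg
    omega
  obtain ⟨b, a, rfl⟩ := Polynomial.exists_eq_X_add_C_of_natDegree_le_one hdeg
  have hcoeff :
      Polynomial.C α + Polynomial.C (2 * β) * Polynomial.X + Polynomial.C γ * Polynomial.X ^ 2 =
        Polynomial.C (a ^ 2) + Polynomial.C (2 * (a * b)) * Polynomial.X +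
          Polynomial.C (b ^ 2) * Polynomial.X ^ 2 := by
    simp only [map_mul, map_pow, map_ofNat]
    linear_combination hg
  have coeff_eq (n : ℕ) := congrArg (Polynomial.coeff · n) hcoeff
  simp only [Polynomial.coeff_add, Polynomial.coeff_C_mul, Polynomial.coeff_C, Polynomial.coeff_X,
    Polynomial.coeff_X_pow] at coeff_eq
  have hα : α = a ^ 2 := by simpa using coeff_eq 0
  have hβ : 2 * β = 2 * (a * b) := by simpa using coeff_eq 1
  have hγ : γ = b ^ 2 := by simpa using coeff_eq 2
  rw [hα, hγ, mul_left_cancel₀ two_ne_zero hβ, mul_pow]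

theorem aeval_algebraMap_comp {R S σ : Type*} [CommSemiring R] [CommSemiring S] [Algebra R S]
    (v : σ → R) (P : MvPolynomial σ R) :
    aeval (algebraMap R S ∘ v) P = algebraMap R S (eval v P) := by
  rw [← coe_aeval_eq_eval]
  exact aeval_algebraMap_apply _ _ _

theorem not_isSquare_branchForm {Q₁ Q₂ Q₃ : TernaryQuadraticForm} (h : quartic Q₁ Q₂ Q₃ ≠ 0) :
    ¬ IsSquare (branchForm Q₁ Q₂ Q₃).1 := by
  intro hsq
  refine h (MvPolynomial.funext fun v => ?_)
  -- `-4 (Q₁ Q₃ - Q₂²)` is the discriminant of the form with respect to `t`.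
  have hv := hsq.map (aeval (Sum.elim ![1, Polynomial.X] (algebraMap ℝ (Polynomial ℝ) ∘ v)))
  simp only [aeval_branchForm, aeval_algebraMap_comp, Matrix.cons_val_zero, Matrix.cons_val_one,
    one_pow, one_mul, mul_one] at hv
  rw [quartic, map_sub, map_mul, map_pow, map_zero, mul_eq_sq_of_isSquare hv, sub_self]

end Irreducibility

section Rationality

theorem adjoin_range_update {k K ι : Type*} [Field k] [Field K] [Algebra k K] [DecidableEq ι]
    {y : ι → K} {i : ι} (hi : y i = 0) (x : K) :
    IntermediateField.adjoin k (Set.range (Function.update y i x)) =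
      IntermediateField.adjoin k ({x} ∪ Set.range y) := by
  apply le_antisymm <;> rw [IntermediateField.adjoin_le_iff]
  · rintro _ ⟨i', rfl⟩
    refine IntermediateField.subset_adjoin _ _ ?_
    rcases eq_or_ne i' i with rfl | h
    · exact Or.inl (Function.update_self ..)
    · exact Or.inr ⟨i', (Function.update_of_ne h ..).symm⟩
  · rintro _ (rfl | ⟨i', rfl⟩)
    · exact IntermediateField.subset_adjoin _ _ ⟨i, Function.update_self ..⟩
    · rcases eq_or_ne i' i with rfl | h
      · exact hi ▸ zero_mem _
      · exact IntermediateField.subset_adjoin _ _ ⟨i', Function.update_of_ne h ..⟩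

variable (F : BranchForm) (K : Type) [Field K] [Algebra ℝ K] [Algebra (CoverRing F) K]
  [IsScalarTower ℝ (CoverRing F) K] [IsFractionRing (CoverRing F) K] (j : Fin 3)

theorem affineCoord_comp_some :
    affineCoord F K j ∘ some =
      Sum.elim ![1, affineCoord F K j (some (.inl 1))]
        fun k => affineCoord F K j (some (.inr k)) := by
  ext (i | k)
  · fin_cases i
    · exact affineCoord_inl_zero F K j
    · rfl
  · rfl

theorem affineCoord_none_notMem (hF : ¬ IsSquare F.1) :
    affineCoord F K j none ∉ IntermediateField.adjoin ℝ (Set.range (affineCoord F K j ∘ some)) := by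
  intro h
  have generic_mem (i : BaseVar) : genericCoord F K (some i) ∈
      IntermediateField.adjoin ℝ (Set.range (genericCoord F K ∘ some)) :=
    IntermediateField.subset_adjoin _ _ ⟨i, rfl⟩
  have hle : IntermediateField.adjoin ℝ (Set.range (affineCoord F K j ∘ some)) ≤
      IntermediateField.adjoin ℝ (Set.range (genericCoord F K ∘ some)) := by
    rw [IntermediateField.adjoin_le_iff, Set.range_subset_iff]
    exact fun i => mul_mem (inv_mem (mul_mem (pow_mem (generic_mem _) _)
      (pow_mem (generic_mem _) _))) (generic_mem i)
  refine genericCoord_none_notMem F K hF ?_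
  rw [genericCoord_eq F K j]
  exact mul_mem (mul_mem (pow_mem (generic_mem _) _) (pow_mem (generic_mem _) _)) (hle h)

theorem add_mul_affineCoord_ne_zero {c : Fin 2 → ℝ} (hc : c ≠ 0) :
    algebraMap ℝ K (c 0) + algebraMap ℝ K (c 1) * affineCoord F K j (some (.inl 1)) ≠ 0 := by
  intro h
  have hlin : LinearIndependent ℝ fun i : Fin 2 => genericCoord F K (some (.inl i)) :=
    ((algebraicIndependent_genericCoord F K).comp Sum.inl Sum.inl_injective).linearIndependent
  refine hc (funext (Fintype.linearIndependent_iff.1 hlin c ?_))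
  rw [Fin.sum_univ_two, genericCoord_eq F K j (some (.inl 0)),
    genericCoord_eq F K j (some (.inl 1)), affineCoord_inl_zero, Algebra.smul_def, Algebra.smul_def]
  simp only [bidegree, baseBidegree, Sum.elim_inl, pow_one, pow_zero, mul_one]
  linear_combination genericCoord F K (some (.inl 0)) * h

theorem range_affineCoord_comp_some :
    Set.range (affineCoord F K j ∘ some) =
      {affineCoord F K j (some (.inl 1))} ∪
        Set.range fun k => affineCoord F K j (some (.inr k)) := by
  rw [affineCoord_comp_some, Set.Sum.elim_range, Matrix.range_cons, Matrix.range_cons,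
    Matrix.range_empty, Set.union_empty, Set.union_assoc, Set.union_eq_right,
    Set.singleton_subset_iff]
  exact Or.inr ⟨j, affineCoord_inr F K j⟩

variable {F K j}

theorem isRationalThreefold_of_genericFiber_point (hF : ¬ IsSquare F.1)
    {q : QuadraticForm K (Fin 3 → K)}
    (hq : ∀ v, q v = aeval (Sum.elim ![1, affineCoord F K j (some (.inl 1))] v) F.1)
    {p : Fin 3 → K} {a : K}
    (hp : ∀ i, p i ∈ IntermediateField.adjoin ℝ {affineCoord F K j (some (.inl 1))})
    (ha : a ∈ IntermediateField.adjoin ℝ {affineCoord F K j (some (.inl 1))})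
    (hj : p j = 1) (ha0 : a ≠ 0) (hqp : q p = a ^ 2) :
    IsRationalThreefold (doubleCover.structureMap F) := by
  have : CharZero K := charZero_of_injective_algebraMap (algebraMap ℝ K).injective
  let τ := affineCoord F K j (some (.inl 1))
  let ξ := fun k => affineCoord F K j (some (.inr k))
  let ω := affineCoord F K j none
  have q_mem (L : IntermediateField ℝ K) (hτ : {τ} ⊆ (L : Set K)) (v : Fin 3 → K)
      (hv : ∀ i, v i ∈ L) : q v ∈ L := by
    rw [hq]
    refine eval₂_mem (fun _ _ => L.algebraMap_mem _) ?_
    rintro (i | k)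
    · fin_cases i
      exacts [one_mem L, hτ rfl]
    · exact hv k
  have hqξ : q ξ = ω ^ 2 := by
    rw [hq, affineCoord_none_sq, affineCoord_comp_some]
  have hω := affineCoord_none_notMem F K j hF
  rw [range_affineCoord_comp_some] at hω
  have hμ : stereographic p a ξ ω j = 0 := by
    simp [stereographic, hj, ξ, affineCoord_inr]
  refine isRationalThreefold_of_adjoin_eq (j := j)
    (y := Function.update (stereographic p a ξ ω) j τ) ?_
  rw [adjoin_range_update hμ, adjoin_stereographic q_mem hp ha ha0 hqp hω hqξ,
    ← range_affineCoord_comp_some]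
  exact congrArg _ (Option.range_eq _).symm

end Rationality

section RealPoints

variable {Q₁ Q₂ Q₃ : TernaryQuadraticForm}

theorem isRationalThreefold_of_eval_eq_sq (hquartic : quartic Q₁ Q₂ Q₃ ≠ 0)
    {p : Fin 3 → ℝ} {j : Fin 3} (hj : p j = 1) {c : Fin 2 → ℝ} (hc : c ≠ 0)
    (h₁ : eval p Q₁.1 = c 0 ^ 2) (h₂ : eval p Q₂.1 = c 0 * c 1) (h₃ : eval p Q₃.1 = c 1 ^ 2) :
    IsRationalThreefold (doubleCover.structureMap (branchForm Q₁ Q₂ Q₃)) := by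
  have hF := not_isSquare_branchForm hquartic
  have := isDomain_coverRing hF
  let K := FractionRing (CoverRing (branchForm Q₁ Q₂ Q₃))
  let τ : K := affineCoord (branchForm Q₁ Q₂ Q₃) K j (some (.inl 1))
  obtain ⟨q, hq⟩ := exists_quadraticForm_eq_aeval_branchForm Q₁ Q₂ Q₃ ![1, τ]
  have hqp : q (algebraMap ℝ K ∘ p) = (algebraMap ℝ K (c 0) + algebraMap ℝ K (c 1) * τ) ^ 2 := by
    rw [hq, aeval_branchForm]
    simp only [aeval_algebraMap_comp, h₁, h₂, h₃, map_mul, map_pow, Matrix.cons_val_zero,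
      Matrix.cons_val_one]
    ring
  exact isRationalThreefold_of_genericFiber_point hF hq (fun i => algebraMap_mem _ _)
    (add_mem (algebraMap_mem _ _) (mul_mem (algebraMap_mem _ _)
      (IntermediateField.mem_adjoin_simple_self ℝ τ)))
    (by rw [hj, map_one]) (add_mul_affineCoord_ne_zero _ _ _ hc) hqp

theorem exists_eq_sq_of_nonneg {α β γ : ℝ} (h : α * γ = β ^ 2) (hα : 0 ≤ α) (hγ : 0 ≤ γ) :
    ∃ c : Fin 2 → ℝ, α = c 0 ^ 2 ∧ β = c 0 * c 1 ∧ γ = c 1 ^ 2 := by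
  have habs : √α * √γ = |β| := by rw [← Real.sqrt_mul hα, h, Real.sqrt_sq_eq_abs]
  rcases abs_choice β with hβ | hβ
  · exact ⟨![√α, √γ], (Real.sq_sqrt hα).symm, (habs.trans hβ).symm, (Real.sq_sqrt hγ).symm⟩
  · refine ⟨![√α, -√γ], (Real.sq_sqrt hα).symm, ?_, ?_⟩
    · simp [habs, hβ]
    · simp [Real.sq_sqrt hγ]

theorem eval_smul (Q : TernaryQuadraticForm) (r : ℝ) (v : Fin 3 → ℝ) :
    eval (r • v) Q.1 = r * r * eval v Q.1 := by
  obtain ⟨q, hq⟩ := exists_quadraticForm_eq_aeval ℝ Q.2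
  rw [← aeval_eq_eval, ← hq, QuadraticMap.map_smul, hq, smul_eq_mul, aeval_eq_eval]

theorem isRationalThreefold_of_eval_nonneg (hquartic : quartic Q₁ Q₂ Q₃ ≠ 0) {p : Fin 3 → ℝ}
    (hp : eval p Q₁.1 * eval p Q₃.1 = eval p Q₂.1 ^ 2) (hQ : eval p Q₁.1 ≠ 0 ∨ eval p Q₃.1 ≠ 0)
    (h₁ : 0 ≤ eval p Q₁.1) (h₃ : 0 ≤ eval p Q₃.1) :
    IsRationalThreefold (doubleCover.structureMap (branchForm Q₁ Q₂ Q₃)) := by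
  obtain ⟨c, hc₁, hc₂, hc₃⟩ := exists_eq_sq_of_nonneg hp h₁ h₃
  have hc : c ≠ 0 := by
    rintro rfl
    simp [hc₁, hc₃] at hQ
  obtain ⟨j, hj⟩ : ∃ j, p j ≠ 0 := by
    refine Function.ne_iff.1 fun hp0 => ?_
    have eval_p (Q : TernaryQuadraticForm) : eval p Q.1 = 0 := by
      simpa [hp0] using eval_smul Q 0 p
    simp [eval_p] at hQ
  refine isRationalThreefold_of_eval_eq_sq hquartic (p := (p j)⁻¹ • p) (inv_mul_cancel₀ hj)
    (smul_ne_zero (inv_ne_zero hj) hc) ?_ ?_ ?_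
  all_goals
    simp only [eval_smul, hc₁, hc₂, hc₃, Pi.smul_apply, smul_eq_mul]
    ring

theorem twistedBranchForm_eq (Q₁ Q₂ Q₃ : TernaryQuadraticForm) :
    twistedBranchForm Q₁ Q₂ Q₃ = branchForm (-Q₁) Q₂ (-Q₃) := by
  refine Subtype.ext ?_
  simp only [twistedBranchForm, branchForm, NegMemClass.coe_neg, map_neg]
  ring

theorem quartic_neg (Q₁ Q₂ Q₃ : TernaryQuadraticForm) :
    quartic (-Q₁) Q₂ (-Q₃) = quartic Q₁ Q₂ Q₃ := by
  simp only [quartic, NegMemClass.coe_neg, neg_mul_neg]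

theorem IsSmoothPlaneCurve.ne_zero {f : MvPolynomial (Fin 3) ℝ} (hf : IsSmoothPlaneCurve f) :
    f ≠ 0 := by
  rintro rfl
  obtain ⟨i, hi⟩ := hf 1 one_ne_zero (map_zero _)
  exact hi (by rw [map_zero, map_zero])

theorem eval_ne_zero_of_isSmoothPlaneCurve (hsmooth : IsSmoothPlaneCurve (quartic Q₁ Q₂ Q₃))
    {p : Fin 3 → ℝ} (hp : p ≠ 0) (hpq : eval p (quartic Q₁ Q₂ Q₃) = 0) :
    eval p Q₁.1 ≠ 0 ∨ eval p Q₃.1 ≠ 0 := by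
  by_contra! h
  obtain ⟨h₁, h₃⟩ := h
  have h₂ : eval p Q₂.1 = 0 := by simpa [quartic, h₁] using hpq
  have hp' : algebraMap ℝ ℂ ∘ p ≠ 0 := by
    simpa [funext_iff] using hp
  obtain ⟨i, hi⟩ := hsmooth (algebraMap ℝ ℂ ∘ p) hp' (by rw [aeval_algebraMap_comp, hpq, map_zero])
  rw [aeval_algebraMap_comp] at hi
  simp [quartic, h₁, h₂, h₃, Derivation.leibniz, Derivation.leibniz_pow] at hi

end RealPoints

end DoubleCover

end

theorem corollary2p11_general (Q₁ Q₂ Q₃ : DoubleCover.TernaryQuadraticForm)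
    (hquartic : DoubleCover.quartic Q₁ Q₂ Q₃ ≠ 0) {p : Fin 3 → ℝ}
    (hp : eval p (DoubleCover.quartic Q₁ Q₂ Q₃) = 0) (hQ : eval p Q₁.1 ≠ 0 ∨ eval p Q₃.1 ≠ 0) :
    DoubleCover.IsRationalThreefold
        (DoubleCover.doubleCover.structureMap (DoubleCover.branchForm Q₁ Q₂ Q₃)) ∨
      DoubleCover.IsRationalThreefold
        (DoubleCover.doubleCover.structureMap (DoubleCover.twistedBranchForm Q₁ Q₂ Q₃)) := by
  have hpq : eval p Q₁.1 * eval p Q₃.1 = eval p Q₂.1 ^ 2 := by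
    simpa [DoubleCover.quartic, sub_eq_zero] using hp
  rcases mul_nonneg_iff.1 (hpq ▸ sq_nonneg (eval p Q₂.1)) with ⟨h₁, h₃⟩ | ⟨h₁, h₃⟩
  · exact Or.inl (DoubleCover.isRationalThreefold_of_eval_nonneg hquartic hpq hQ h₁ h₃)
  · rw [DoubleCover.twistedBranchForm_eq]
    rw [← DoubleCover.quartic_neg] at hquartic
    exact Or.inr (DoubleCover.isRationalThreefold_of_eval_nonneg hquartic (by simpa using hpq)
      (by simpa using hQ) (by simpa using h₁) (by simpa using h₃))

theorem corollary2p11 (Q₁ Q₂ Q₃ : DoubleCover.TernaryQuadraticForm)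
    (hsmooth : DoubleCover.IsSmoothPlaneCurve (DoubleCover.quartic Q₁ Q₂ Q₃))
    (hreal : (DoubleCover.realPoints (DoubleCover.quartic Q₁ Q₂ Q₃)).Nonempty) :
    DoubleCover.IsRationalThreefold
        (DoubleCover.doubleCover.structureMap (DoubleCover.branchForm Q₁ Q₂ Q₃)) ∨
      DoubleCover.IsRationalThreefold
        (DoubleCover.doubleCover.structureMap (DoubleCover.twistedBranchForm Q₁ Q₂ Q₃)) := by
  obtain ⟨x, hx⟩ := hreal
  exact corollary2p11_general Q₁ Q₂ Q₃ hsmooth.ne_zero hx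
    (DoubleCover.eval_ne_zero_of_isSmoothPlaneCurve hsmooth x.rep_nonzero hx)
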